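/- A permutation $\pi\in S_n$ contains a pattern $p\in S_m$ if its one-line notation has a subsequence that is order-isomorphic to $p$; otherwise it avoids $p$. Let $\mathrm{av}_n^k(1324,1342)$ denote the number of permutations $\pi\in S_n$ that avoid both $1324$ and $1342$ and have exactly $k$ inversions, i.e. exactly $k$ pairs $i<j$ with $\pi_i>\pi_j$. Let $$C(x)=\prod_{i\ge 1}\frac{1+x^i}{1-x^i}$$ as a formal power series. Then $C(x)$ is the limit generating function of $\{1324,1342\}$: for every $k\ge 0$ one has $\mathrm{av}_n^k(1324,1342)=[x^k]\,C(x)$ for all sufficiently large $n$. Moreover, for all nonnegative integers $k$ and $n$ with $n\ge\frac{k+7}{2}$, the difference $\mathrm{av}_{n+1}^k(1324,1342)-\mathrm{av}_n^k(1324,1342)$ is nonnegative and $$\mathrm{av}_{n+1}^k(1324,1342)-\mathrm{av}_n^k(1324,1342)=[x^k]\;x^{n-1}(2+2x)\prod_{i\ge1}\frac{1+x^i}{1-x^i},$$ $$\mathrm{av}_n^k(1324,1342)=[x^k]\left(\frac{1-x-x^{n-1}(2+2x)}{1-x}\cdot\prod_{i\ge1}\frac{1+x^i}{1-x^i}\right).$$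 -/

import Mathlib

open PowerSeries
open scoped PowerSeries.WithPiTopology

/-- `π ∈ S_n` contains the pattern `p ∈ S_m`: some subsequence of the one-line notation of `π`,
at positions `f 0 < f 1 < ⋯`, is order-isomorphic to `p`. -/
def ContainsPattern {m n : ℕ} (p : Equiv.Perm (Fin m)) (π : Equiv.Perm (Fin n)) : Prop :=
  ∃ f : Fin m ↪o Fin n, ∀ i j : Fin m, p i < p j ↔ π (f i) < π (f j)

/-- `π` avoids every pattern in the collection `B` of permutations of arbitrary lengths. -/
def AvoidsAll {n : ℕ} (B : Set (Σ m : ℕ, Equiv.Perm (Fin m))) (π : Equiv.Perm (Fin n)) : Prop :=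
  ∀ p ∈ B, ¬ ContainsPattern p.2 π

/-- The number of inversions, i.e. of pairs `i < j` with `π i > π j`. -/
def inversionCount {n : ℕ} (π : Equiv.Perm (Fin n)) : ℕ :=
  (Finset.univ.filter fun q : Fin n × Fin n => q.1 < q.2 ∧ π q.2 < π q.1).card

/-- `Av_n^k(B)`: the `B`-avoiding permutations of length `n` with exactly `k` inversions. -/
def AvSet (n k : ℕ) (B : Set (Σ m : ℕ, Equiv.Perm (Fin m))) : Set (Equiv.Perm (Fin n)) :=
  {π | AvoidsAll B π ∧ inversionCount π = k}

/-- `av_n^k(B)`, the cardinality of `Av_n^k(B)`. -/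
noncomputable def av (n k : ℕ) (B : Set (Σ m : ℕ, Equiv.Perm (Fin m))) : ℕ :=
  (AvSet n k B).ncard

/-- `C` is the limit generating function of `B`: for every `k`, the numbers `av_n^k(B)` are equal
to the coefficient of `x^k` in `C` for all sufficiently large `n`. -/
def IsLimitGenFun (B : Set (Σ m : ℕ, Equiv.Perm (Fin m))) (C : ℚ⟦X⟧) : Prop :=
  ∀ k : ℕ, ∃ N : ℕ, ∀ n : ℕ, N ≤ n → (av n k B : ℚ) = coeff k C

/-- The permutation `1324` (with positions and values shifted to start at `0`). -/
def perm1324 : Equiv.Perm (Fin 4) :=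
  ⟨![0, 2, 1, 3], ![0, 2, 1, 3], by decide, by decide⟩

/-- The permutation `1342` (with positions and values shifted to start at `0`). -/
def perm1342 : Equiv.Perm (Fin 4) :=
  ⟨![0, 2, 3, 1], ![0, 3, 1, 2], by decide, by decide⟩

/-- The collection `{1324, 1342}`. -/
def basis1324And1342 : Set (Σ m : ℕ, Equiv.Perm (Fin m)) :=
  {⟨4, perm1324⟩, ⟨4, perm1342⟩}

/-- The infinite product `∏_{i ≥ 1} (1 + x^i) / (1 - x^i)` of formal power series. -/
noncomputable def overpartitionSeries : ℚ⟦X⟧ :=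
  ∏' i : ℕ, (1 + X ^ (i + 1)) * (1 - X ^ (i + 1))⁻¹

/-- The infinite product defining `overpartitionSeries` converges. -/
theorem multipliable_overpartitionSeries :
    Multipliable fun i : ℕ => (1 + X ^ (i + 1) : ℚ⟦X⟧) * (1 - X ^ (i + 1))⁻¹ := by
  have key : ∀ i : ℕ, (1 + X ^ (i + 1) : ℚ⟦X⟧) * (1 - X ^ (i + 1))⁻¹
      = 1 + X ^ (i + 1) * (2 * (1 - X ^ (i + 1))⁻¹) := by
    intro i
    have h : (1 - X ^ (i + 1) : ℚ⟦X⟧) * (1 - X ^ (i + 1))⁻¹ = 1 :=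
      PowerSeries.mul_inv_cancel _ (by simp)
    linear_combination h
  simp_rw [key]
  apply PowerSeries.WithPiTopology.multipliable_one_add_of_tendsto_order_atTop_nhds_top
  refine ENat.tendsto_nhds_top_iff_natCast_lt.mpr fun n => Filter.eventually_atTop.mpr ⟨n, ?_⟩
  intro i hi
  refine lt_of_lt_of_le ?_ (PowerSeries.le_order_mul ..)
  rw [PowerSeries.order_X_pow]
  exact lt_of_lt_of_le (by exact_mod_cast Nat.lt_succ_of_le hi) le_self_add

/-! Build permutations by prepending a first entry `v`, which creates `v` inversions. Avoidance then
only requires remembering a threshold `μ` above which 213 and 231 are forbidden, so the inversion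
series G(n, μ) = `goodSeries n μ` satisfy a recursion in n: sum x^v G(n, v) over v ≤ μ, plus x^n
G(n, μ) when μ < n.

The series P_μ = `pairSeries M μ`, with M a large cutoff standing for infinity, satisfy ∑_{v ≤ μ}
x^v P_v = P_μ, so they are fixed by the recursion without its x^n term. Hence G(n, μ) agrees with
P_μ up to order about n. Feeding this back gives the correction linear in x^n (`firstOrder`), valid
up to order about 2n, because neglected terms carry two factors of size about x^n. Taking μ = n
gives P_M (1 - x^(n-1)(2+2x)/(1-x)), and P_M tends to the overpartition product. -/

/-! ### Prepending an entry and counting inversions. -/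

/-- The permutation whose first entry is `v` and whose remaining entries are order-isomorphic
to `σ`. -/
def prependPerm {n : ℕ} (v : Fin (n + 1)) (σ : Equiv.Perm (Fin n)) : Equiv.Perm (Fin (n + 1)) :=
  (finSuccEquiv' 0).trans ((Equiv.optionCongr σ).trans (finSuccEquiv' v).symm)

theorem prependPerm_zero {n : ℕ} (v : Fin (n + 1)) (σ : Equiv.Perm (Fin n)) :
    prependPerm v σ 0 = v := by
  simp [prependPerm]

theorem prependPerm_succ {n : ℕ} (v : Fin (n + 1)) (σ : Equiv.Perm (Fin n)) (i : Fin n) :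
    prependPerm v σ i.succ = v.succAbove (σ i) := by
  have h : finSuccEquiv' (0 : Fin (n + 1)) i.succ = some i := by
    rw [← Fin.succAbove_zero, finSuccEquiv'_succAbove]
  simp [prependPerm, h]

theorem prependPerm_bijective (n : ℕ) :
    Function.Bijective fun q : Fin (n + 1) × Equiv.Perm (Fin n) => prependPerm q.1 q.2 := by
  rw [Fintype.bijective_iff_injective_and_card]
  refine ⟨?_, by simp [Fintype.card_perm, Nat.factorial_succ]⟩
  rintro ⟨v, σ⟩ ⟨w, τ⟩ h
  have h0 : v = w := by
    have := congrArg (fun π : Equiv.Perm (Fin (n + 1)) => π 0) h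
    simpa [prependPerm_zero] using this
  subst h0
  refine Prod.ext rfl (Equiv.ext fun i => ?_)
  have := congrArg (fun π : Equiv.Perm (Fin (n + 1)) => π i.succ) h
  simpa [prependPerm_succ] using this

theorem val_succAbove {n : ℕ} (v : Fin (n + 1)) (i : Fin n) :
    (v.succAbove i : ℕ) = if (i : ℕ) < v then (i : ℕ) else i + 1 := by
  simp only [Fin.succAbove, Fin.lt_def, Fin.val_castSucc]
  split_ifs <;> simp

theorem lt_succAbove_iff_le_val {n : ℕ} (v : Fin (n + 1)) (i : Fin n) :
    v < v.succAbove i ↔ (v : ℕ) ≤ i := by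
  rw [Fin.lt_def, val_succAbove]
  split_ifs <;> omega

theorem succAbove_lt_iff_val_lt {n : ℕ} (v : Fin (n + 1)) (i : Fin n) :
    v.succAbove i < v ↔ (i : ℕ) < v := by
  rw [Fin.lt_def, val_succAbove]
  split_ifs <;> omega

theorem sum_succAbove_lt {n : ℕ} (v : Fin (n + 1)) (σ : Equiv.Perm (Fin n)) :
    (∑ i : Fin n, if v.succAbove (σ i) < v then 1 else 0) = (v : ℕ) := by
  rw [Equiv.sum_comp σ (fun i : Fin n => if v.succAbove i < v then 1 else 0)]
  simp only [succAbove_lt_iff_val_lt]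
  rw [Fin.sum_univ_eq_sum_range (fun i => if i < (v : ℕ) then 1 else 0) n, ← Finset.sum_filter]
  have : (Finset.range n).filter (· < (v : ℕ)) = Finset.range v := by
    ext i
    simp
    omega
  simp [this]

theorem inversionCount_eq_sum {n : ℕ} (π : Equiv.Perm (Fin n)) :
    inversionCount π = ∑ i : Fin n, ∑ j : Fin n, if i < j ∧ π j < π i then 1 else 0 := by
  rw [inversionCount, Finset.card_filter, Fintype.sum_prod_type]

theorem inversionCount_prependPerm {n : ℕ} (v : Fin (n + 1)) (σ : Equiv.Perm (Fin n)) :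
    inversionCount (prependPerm v σ) = v + inversionCount σ := by
  rw [inversionCount_eq_sum, inversionCount_eq_sum, Fin.sum_univ_succ, Fin.sum_univ_succ]
  simp only [Fin.sum_univ_succ (n := n), prependPerm_zero, prependPerm_succ, lt_irrefl, false_and,
    Fin.succ_pos, true_and, Fin.not_lt_zero, if_false, zero_add, Fin.succ_lt_succ_iff,
    Fin.succAbove_lt_succAbove_iff]
  rw [sum_succAbove_lt]

/-! ### Avoidance as a threshold condition. -/

/-- `σ` avoids `1324` and `1342`, and its entries that are at least `μ` avoid `213` and `231`. -/
def GoodAbove {n : ℕ} (μ : ℕ) (σ : Equiv.Perm (Fin n)) : Prop :=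
  (∀ i j k l : Fin n, i < j → j < k → j < l → σ i < σ k → σ k < σ j → ¬ σ j < σ l) ∧
  ∀ j k l : Fin n, j < k → j < l → μ ≤ (σ k : ℕ) → σ k < σ j → ¬ σ j < σ l

theorem containsPattern_of_four {n : ℕ} (p : Equiv.Perm (Fin 4)) (π : Equiv.Perm (Fin n))
    (a : Fin 4 → Fin n) (ha : StrictMono a)
    (h : ∀ i j, p i < p j → π (a i) < π (a j)) : ContainsPattern p π := by
  refine ⟨OrderEmbedding.ofStrictMono a ha, fun i j => ⟨h i j, fun hij => ?_⟩⟩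
  by_contra hn
  rcases (not_lt.mp hn).lt_or_eq with h1 | h1
  · exact lt_asymm hij (h j i h1)
  · rw [p.injective h1] at hij
    exact lt_irrefl _ hij

/-- Leaving the order of positions `k` and `l` free in `GoodAbove` covers both patterns at once; at
threshold `n` the second clause is vacuous. -/
theorem avoidsAll_iff_goodAbove {n : ℕ} (π : Equiv.Perm (Fin n)) :
    AvoidsAll basis1324And1342 π ↔ GoodAbove n π := by
  have hvac : ∀ j k l : Fin n, j < k → j < l → n ≤ (π k : ℕ) → π k < π j → ¬ π j < π l :=
    fun j k l _ _ h => absurd (π k).isLt (not_lt.mpr h)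
  constructor
  · intro h
    refine ⟨fun i j k l hij hjk hjl h1 h2 h3 => ?_, hvac⟩
    rcases lt_trichotomy k l with hkl | hkl | hkl
    · refine h ⟨4, perm1324⟩ (by simp [basis1324And1342])
        (containsPattern_of_four _ _ ![i, j, k, l] ?_ ?_)
      · rw [Fin.strictMono_iff_lt_succ]
        intro t
        fin_cases t <;> simp [*]
      · intro s t
        fin_cases s <;> fin_cases t <;> simp [perm1324] <;> order
    · subst hkl
      exact lt_asymm h2 h3
    · refine h ⟨4, perm1342⟩ (by simp [basis1324And1342])
        (containsPattern_of_four _ _ ![i, j, l, k] ?_ ?_)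
      · rw [Fin.strictMono_iff_lt_succ]
        intro t
        fin_cases t <;> simp [*]
      · intro s t
        fin_cases s <;> fin_cases t <;> simp [perm1342] <;> order
  · rintro h p hp ⟨f, hf⟩
    simp only [basis1324And1342, Set.mem_insert_iff, Set.mem_singleton_iff] at hp
    rcases hp with rfl | rfl
    · exact h.1 (f 0) (f 1) (f 2) (f 3) (f.strictMono (by decide)) (f.strictMono (by decide))
        (f.strictMono (by decide)) ((hf _ _).1 (by decide)) ((hf _ _).1 (by decide))
        ((hf _ _).1 (by decide))
    · exact h.1 (f 0) (f 1) (f 3) (f 2) (f.strictMono (by decide)) (f.strictMono (by decide))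
        (f.strictMono (by decide)) ((hf _ _).1 (by decide)) ((hf _ _).1 (by decide))
        ((hf _ _).1 (by decide))

/-- A first entry `v` acts as the 1 of either pattern, lowering the threshold to `v`. If `v` exceeds
`μ`, it would itself be the 2 of a 213 or 231 unless it is the maximum, and a maximal first entry is
harmless. -/
theorem goodAbove_prependPerm {n μ : ℕ} (v : Fin (n + 1)) (σ : Equiv.Perm (Fin n)) :
    GoodAbove μ (prependPerm v σ) ↔
      ((v : ℕ) ≤ μ ∧ GoodAbove v σ) ∨ (μ < v ∧ (v : ℕ) = n ∧ GoodAbove μ σ) := by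
  constructor
  · rintro ⟨h1, h2⟩
    have hσ : ∀ i j k l : Fin n, i < j → j < k → j < l → σ i < σ k → σ k < σ j → ¬ σ j < σ l := by
      intro i j k l
      simpa [prependPerm_succ] using h1 i.succ j.succ k.succ l.succ
    rcases le_or_gt (v : ℕ) μ with hv | hv
    · refine Or.inl ⟨hv, hσ, fun j k l hjk hjl hk hkj hjl' => ?_⟩
      refine h1 0 j.succ k.succ l.succ (Fin.succ_pos _) ?_ ?_ ?_ ?_ ?_ <;>
        simpa [prependPerm_zero, prependPerm_succ, lt_succAbove_iff_le_val]
    · refine Or.inr ⟨hv, ?_, hσ, fun j k l hjk hjl hk hkj hjl' => ?_⟩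
      · by_contra hne
        have hvn : (v : ℕ) < n := by omega
        -- After prepending, the values `μ` and `v` of `σ` become `μ` and `v + 1`, which together
        -- with the first entry `v` form 213 or 231.
        refine h2 0 (σ.symm ⟨μ, by omega⟩).succ (σ.symm ⟨v, hvn⟩).succ (Fin.succ_pos _)
          (Fin.succ_pos _) ?_ ?_ ?_
        · simp [prependPerm_succ, val_succAbove, hv]
        · simpa [prependPerm_zero, prependPerm_succ, succAbove_lt_iff_val_lt] using hv
        · simp [prependPerm_zero, prependPerm_succ, lt_succAbove_iff_le_val]
      · refine h2 j.succ k.succ l.succ (by simpa) (by simpa) ?_ ?_ ?_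
        · rw [prependPerm_succ, val_succAbove]
          split_ifs <;> omega
        · simpa [prependPerm_succ]
        · simpa [prependPerm_succ]
  · intro h
    have hσ : ∀ i j k l : Fin n, i < j → j < k → j < l → σ i < σ k → σ k < σ j → ¬ σ j < σ l :=
      h.elim (fun h => h.2.1) (fun h => h.2.2.1)
    refine ⟨fun i j k l hij hjk hjl => ?_, fun j k l hjk hjl => ?_⟩
    · obtain ⟨j, rfl⟩ := Fin.exists_succ_eq.2 (Fin.ne_zero_of_lt hij)
      obtain ⟨k, rfl⟩ := Fin.exists_succ_eq.2 (Fin.ne_zero_of_lt hjk)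
      obtain ⟨l, rfl⟩ := Fin.exists_succ_eq.2 (Fin.ne_zero_of_lt hjl)
      simp only [Fin.succ_lt_succ_iff] at hjk hjl
      refine Fin.cases (fun _ => ?_) (fun i hij => ?_) i hij
      · simp only [prependPerm_zero, prependPerm_succ, lt_succAbove_iff_le_val,
          Fin.succAbove_lt_succAbove_iff]
        intro hk
        rcases h with ⟨_, h⟩ | ⟨_, hv, _⟩
        · exact h.2 j k l hjk hjl hk
        · have := (σ k).isLt
          omega
      · simpa [prependPerm_succ] using hσ i j k l (by simpa using hij) hjk hjl
    · obtain ⟨k, rfl⟩ := Fin.exists_succ_eq.2 (Fin.ne_zero_of_lt hjk)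
      obtain ⟨l, rfl⟩ := Fin.exists_succ_eq.2 (Fin.ne_zero_of_lt hjl)
      refine Fin.cases (fun _ _ => ?_) (fun j hjk hjl => ?_) j hjk hjl
      · simp only [prependPerm_zero, prependPerm_succ, lt_succAbove_iff_le_val,
          succAbove_lt_iff_val_lt, val_succAbove]
        intro hk hkv hl
        rw [if_pos hkv] at hk
        have := (σ l).isLt
        omega
      · simp only [prependPerm_succ, val_succAbove, Fin.succAbove_lt_succAbove_iff]
        simp only [Fin.succ_lt_succ_iff] at hjk hjl
        intro hk
        rcases h with ⟨hv, h⟩ | ⟨_, hv, h⟩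
        · exact h.2 j k l hjk hjl (by split_ifs at hk <;> omega)
        · refine h.2 j k l hjk hjl ?_
          rwa [if_pos (by have := (σ k).isLt; omega)] at hk

/-! ### The recursion for the inversion series. -/

open Classical in
/-- The inversion generating function of the permutations of length `n` satisfying
`GoodAbove μ`. -/
noncomputable def goodSeries (n μ : ℕ) : ℚ⟦X⟧ :=
  ∑ σ : Equiv.Perm (Fin n), if GoodAbove μ σ then X ^ inversionCount σ else 0

theorem coeff_goodSeries (n k : ℕ) :
    coeff k (goodSeries n n) = (av n k basis1324And1342 : ℚ) := by
  classical
  have : AvSet n k basis1324And1342 =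
      ((Finset.univ.filter fun σ : Equiv.Perm (Fin n) =>
        GoodAbove n σ ∧ inversionCount σ = k : Finset _) : Set (Equiv.Perm (Fin n))) := by
    ext σ
    simp [AvSet, avoidsAll_iff_goodAbove]
  rw [av, this, Set.ncard_coe_finset, goodSeries, map_sum, Finset.card_filter, Nat.cast_sum]
  refine Finset.sum_congr rfl fun σ _ => ?_
  by_cases h : GoodAbove n σ <;> simp [h, coeff_X_pow, eq_comm]

theorem goodSeries_zero (μ : ℕ) : goodSeries 0 μ = 1 := by
  have h : ∀ σ : Equiv.Perm (Fin 0), GoodAbove μ σ := fun σ =>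
    ⟨fun i => i.elim0, fun i => i.elim0⟩
  simp [goodSeries, h, inversionCount]

theorem goodSeries_succ (n μ : ℕ) :
    goodSeries (n + 1) μ = ∑ v ∈ Finset.range (n + 1),
      if v ≤ μ then X ^ v * goodSeries n v else if v = n then X ^ v * goodSeries n μ else 0 := by
  classical
  rw [goodSeries, ← (prependPerm_bijective n).sum_comp, Fintype.sum_prod_type,
    ← Fin.sum_univ_eq_sum_range (fun v => if v ≤ μ then X ^ v * goodSeries n v
      else if v = n then X ^ v * goodSeries n μ else 0)]
  refine Finset.sum_congr rfl fun v _ => ?_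
  simp only [goodAbove_prependPerm, inversionCount_prependPerm, goodSeries, Finset.mul_sum, pow_add]
  split_ifs with h1 h2
  · refine Finset.sum_congr rfl fun σ _ => ?_
    simp [h1, not_lt.2 h1]
  · refine Finset.sum_congr rfl fun σ _ => ?_
    have h3 : μ < n := h2 ▸ not_le.1 h1
    simp [h2, h3, not_le.2 h3]
  · simp [h1, h2]

theorem goodSeries_succ_of_lt {n μ : ℕ} (h : μ < n) :
    goodSeries (n + 1) μ =
      ∑ v ∈ Finset.range (μ + 1), X ^ v * goodSeries n v + X ^ n * goodSeries n μ := by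
  rw [goodSeries_succ, Finset.sum_range_succ, if_neg (by omega), if_pos rfl]
  congr 1
  have hs : Finset.range (μ + 1) ⊆ Finset.range n := Finset.range_subset_range.2 h
  rw [← Finset.sum_subset hs]
  · refine Finset.sum_congr rfl fun v hv => if_pos ?_
    have := Finset.mem_range.1 hv
    omega
  · intro v hv hv'
    simp only [Finset.mem_range] at hv hv'
    rw [if_neg (by omega), if_neg (by omega)]

theorem goodSeries_succ_of_le {n μ : ℕ} (h : n ≤ μ) :
    goodSeries (n + 1) μ = ∑ v ∈ Finset.range (n + 1), X ^ v * goodSeries n v := by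
  rw [goodSeries_succ]
  refine Finset.sum_congr rfl fun v hv => if_pos ?_
  have := Finset.mem_range.1 hv
  omega

theorem one_sub_X_mul_inv : (1 - X : ℚ⟦X⟧) * (1 - X)⁻¹ = 1 :=
  PowerSeries.mul_inv_cancel _ (by simp)

theorem one_sub_X_pow_mul_inv (i : ℕ) : (1 - X ^ (i + 1) : ℚ⟦X⟧) * (1 - X ^ (i + 1))⁻¹ = 1 :=
  PowerSeries.mul_inv_cancel _ (by simp)

/-! ### Closed forms for thresholds 0 and 1. -/

theorem goodSeries_at_zero (n : ℕ) :
    goodSeries n 0 = ∏ i ∈ Finset.Ico 1 n, (1 + X ^ i : ℚ⟦X⟧) := by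
  induction n with
  | zero => simp [goodSeries_zero]
  | succ n ih =>
    rcases Nat.eq_zero_or_pos n with rfl | hn
    · simp [goodSeries_succ_of_le le_rfl, goodSeries_zero]
    · rw [goodSeries_succ_of_lt hn, Finset.prod_Ico_succ_top hn, zero_add, Finset.sum_range_one, ih]
      ring

theorem goodSeries_at_one (n : ℕ) :
    goodSeries (n + 2) 1 =
      (∏ i ∈ Finset.Ico 1 (n + 1), (1 + X ^ i : ℚ⟦X⟧)) * (1 - X ^ (n + 2)) * (1 - X)⁻¹ := by
  induction n with
  | zero =>
    rw [goodSeries_succ_of_le le_rfl]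
    simp only [Finset.sum_range_succ, Finset.sum_range_zero, goodSeries_at_zero,
      goodSeries_succ_of_le (Nat.zero_le 1), goodSeries_zero]
    simp
    linear_combination (-1 - X) * one_sub_X_mul_inv
  | succ n ih =>
    rw [goodSeries_succ_of_lt (by omega), Finset.prod_Ico_succ_top (by omega)]
    simp only [Finset.sum_range_succ, Finset.sum_range_zero, ih, goodSeries_at_zero]
    rw [Finset.prod_Ico_succ_top (by omega)]
    linear_combination (-(∏ i ∈ Finset.Ico 1 (n + 1), (1 + X ^ i : ℚ⟦X⟧)) * (1 + X ^ (n + 1))) *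
      one_sub_X_mul_inv

/-! ### Truncated products and the fixed point of the recursion. -/

/-- The first-order expansion of a product of factors close to `1`. -/
theorem X_pow_dvd_prod_one_add (a : ℚ⟦X⟧) {n M e : ℕ} (hM : e ≤ M) (he : e ≤ 2 * n) (hn : n ≤ M) :
    X ^ e ∣ (∏ i ∈ Finset.Ico n M, (1 + a * X ^ i)) - (1 + a * X ^ n * (1 - X)⁻¹) := by
  have key : ∀ m, n ≤ m → X ^ e ∣ (∏ i ∈ Finset.Ico n m, (1 + a * X ^ i)) -
      (1 + a * (X ^ n - X ^ m) * (1 - X)⁻¹) := by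
    intro m hm
    induction m, hm using Nat.le_induction with
    | base => simp
    | succ m hm ih =>
      rw [Finset.prod_Ico_succ_top hm]
      -- Products of two correction terms have order at least 2n, hence are negligible.
      have h2 : (X ^ e : ℚ⟦X⟧) ∣ X ^ m * (X ^ n - X ^ m) := by
        obtain ⟨d, rfl⟩ := Nat.exists_eq_add_of_le hm
        refine (pow_dvd_pow X he).trans ⟨X ^ d * (1 - X ^ d), by ring⟩
      convert (ih.mul_right (1 + a * X ^ m)).add (h2.mul_right (a ^ 2 * (1 - X)⁻¹)) using 1
      linear_combination (-a * X ^ m) * one_sub_X_mul_inv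
  have hXM : (X ^ e : ℚ⟦X⟧) ∣ X ^ M := pow_dvd_pow X hM
  convert (key M hn).sub (hXM.mul_right (a * (1 - X)⁻¹)) using 1
  ring

/-- The generating function of pairs of a partition into distinct parts smaller than `M` and a
partition into parts at most `μ`. -/
noncomputable def pairSeries (M μ : ℕ) : ℚ⟦X⟧ :=
  (∏ i ∈ Finset.Ico 1 M, (1 + X ^ i)) * ∏ i ∈ Finset.range μ, (1 - X ^ (i + 1))⁻¹

theorem pairSeries_succ (M μ : ℕ) :
    pairSeries M (μ + 1) * (1 - X ^ (μ + 1)) = pairSeries M μ := by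
  rw [pairSeries, pairSeries, Finset.prod_range_succ]
  linear_combination ((∏ i ∈ Finset.Ico 1 M, (1 + X ^ i : ℚ⟦X⟧)) *
    ∏ i ∈ Finset.range μ, (1 - X ^ (i + 1) : ℚ⟦X⟧)⁻¹) * one_sub_X_pow_mul_inv μ

theorem pairSeries_zero (M : ℕ) : pairSeries M 0 = ∏ i ∈ Finset.Ico 1 M, (1 + X ^ i : ℚ⟦X⟧) := by
  simp [pairSeries]

theorem pairSeries_one (M : ℕ) : pairSeries M 1 = pairSeries M 0 * (1 - X)⁻¹ := by
  simp [pairSeries]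

/-- Telescopes, since x^v P_v = P_v - P_{v-1}. -/
theorem sum_X_pow_mul_pairSeries (M μ : ℕ) :
    ∑ v ∈ Finset.range (μ + 1), X ^ v * pairSeries M v = pairSeries M μ := by
  induction μ with
  | zero => simp
  | succ μ ih =>
    rw [Finset.sum_range_succ, ih]
    linear_combination -pairSeries_succ M μ

theorem pairSeries_eq_mul_prod (M : ℕ) {μ ν : ℕ} (h : μ ≤ ν) :
    pairSeries M μ = pairSeries M ν * ∏ i ∈ Finset.Ico (μ + 1) (ν + 1), (1 + -1 * X ^ i) := by
  induction ν, h using Nat.le_induction with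
  | base => simp
  | succ ν h ih =>
    rw [Finset.prod_Ico_succ_top (by omega), ih]
    linear_combination -(∏ i ∈ Finset.Ico (μ + 1) (ν + 1), (1 + -1 * X ^ i : ℚ⟦X⟧)) *
      pairSeries_succ M ν

theorem X_pow_dvd_goodSeries_at_zero {n M e : ℕ} (hn : 1 ≤ n) (he : e ≤ 2 * n) (hM : 2 * n ≤ M) :
    X ^ e ∣ goodSeries n 0 - pairSeries M 0 * (1 - X ^ n * (1 - X)⁻¹) := by
  obtain ⟨w, hw⟩ := X_pow_dvd_prod_one_add 1 (he.trans hM) he (show n ≤ M by omega)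
  simp only [one_mul] at hw
  have h2 : (X ^ e : ℚ⟦X⟧) ∣ X ^ n * X ^ n := by
    rw [← pow_add]; exact pow_dvd_pow X (by omega)
  rw [goodSeries_at_zero, pairSeries_zero,
    ← Finset.prod_Ico_consecutive _ hn (show n ≤ M by omega)]
  set P := ∏ i ∈ Finset.Ico 1 n, (1 + X ^ i : ℚ⟦X⟧)
  convert (h2.mul_right (P * (1 - X)⁻¹ ^ 2)).sub
    ((dvd_mul_right (X ^ e) w).mul_right (P * (1 - X ^ n * (1 - X)⁻¹))) using 1
  linear_combination (-P * (1 - X ^ n * (1 - X)⁻¹)) * hw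

theorem X_pow_dvd_goodSeries_at_one {n M e : ℕ} (he : e ≤ 2 * n + 2) (hM : 2 * n + 2 ≤ M) :
    X ^ e ∣ goodSeries (n + 2) 1 - (pairSeries M 1 * (1 - X ^ (n + 2) * (1 - X)⁻¹) -
      X ^ (n + 1) * (1 + X) * (1 - X)⁻¹ * pairSeries M 0) := by
  obtain ⟨w, hw⟩ := X_pow_dvd_prod_one_add 1 (he.trans hM) (show e ≤ 2 * (n + 1) by omega)
    (show n + 1 ≤ M by omega)
  simp only [one_mul] at hw
  have h2 : (X ^ e : ℚ⟦X⟧) ∣ X ^ (n + 1) * X ^ (n + 1) := by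
    rw [← pow_add]; exact pow_dvd_pow X (by omega)
  rw [goodSeries_at_one, pairSeries_one, pairSeries_zero,
    ← Finset.prod_Ico_consecutive _ (show 1 ≤ n + 1 by omega) (show n + 1 ≤ M by omega)]
  set P := ∏ i ∈ Finset.Ico 1 (n + 1), (1 + X ^ i : ℚ⟦X⟧)
  set T := ∏ i ∈ Finset.Ico (n + 1) M, (1 + X ^ i : ℚ⟦X⟧)
  have hy := one_sub_X_mul_inv
  set y := (1 - X : ℚ⟦X⟧)⁻¹
  have hb : 1 - X ^ (n + 2) * y - X ^ (n + 1) * (1 + X) = 1 - X ^ (n + 1) * y - X ^ (n + 2) := by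
    linear_combination X ^ (n + 1) * hy
  have hF : P * (1 - X ^ (n + 2)) * y - (P * T * y * (1 - X ^ (n + 2) * y) -
      X ^ (n + 1) * (1 + X) * y * (P * T)) =
      P * y * ((1 - X ^ (n + 2)) - T * (1 - X ^ (n + 1) * y - X ^ (n + 2))) := by
    linear_combination (-P * y * T) * hb
  rw [hF]
  convert (h2.mul_right (P * y * (y ^ 2 + X * y))).sub
    ((dvd_mul_right (X ^ e) w).mul_right (P * y * (1 - X ^ (n + 1) * y - X ^ (n + 2)))) using 1
  linear_combination (-P * y * (1 - X ^ (n + 1) * y - X ^ (n + 2))) * hw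

/-! ### Zeroth-order and first-order approximation. -/

theorem X_pow_dvd_goodSeries_sub_pairSeries {M : ℕ} (n : ℕ) :
    ∀ μ e : ℕ, 2 * n ≤ M → μ ≤ n → e + 1 ≤ n → X ^ e ∣ goodSeries n μ - pairSeries M μ := by
  induction n with
  | zero => intro μ e _ _ he; omega
  | succ n ih =>
    intro μ e hM hμ he
    rcases Nat.eq_zero_or_pos e with rfl | he0
    · simp
    have hXn : (X ^ e : ℚ⟦X⟧) ∣ X ^ n := pow_dvd_pow X (by omega)
    have hsum : ∀ m ≤ n, X ^ e ∣ ∑ v ∈ Finset.range (m + 1), X ^ v * goodSeries n v -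
        pairSeries M m := by
      intro m hm
      rw [← sum_X_pow_mul_pairSeries, ← Finset.sum_sub_distrib]
      refine Finset.dvd_sum fun v hv => ?_
      rw [← mul_sub]
      have hv' := Finset.mem_range.1 hv
      -- For v ≥ 1 the factor x^v supplies the order gained at each step; v = 0 gains nothing and
      -- needs the closed form.
      rcases Nat.eq_zero_or_pos v with rfl | hv0
      · have h0 := X_pow_dvd_goodSeries_at_zero (n := n) (M := M) (e := e) (by omega) (by omega)
          (by omega)
        convert h0.sub (hXn.mul_right (pairSeries M 0 * (1 - X)⁻¹)) using 1
        ring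
      · have h1 := ih v (e - 1) (by omega) (by omega) (by omega)
        refine (pow_dvd_pow X (show e ≤ v + (e - 1) by omega)).trans ?_
        rw [pow_add]
        exact mul_dvd_mul_left _ h1
    rcases lt_or_ge μ n with h | h
    · rw [goodSeries_succ_of_lt h]
      convert (hsum μ h.le).add (hXn.mul_right (goodSeries n μ)) using 1
      ring
    · rw [goodSeries_succ_of_le h]
      rcases h.eq_or_lt with rfl | h'
      · exact hsum _ le_rfl
      · obtain rfl : μ = n + 1 := by omega
        convert (hsum n le_rfl).sub (hXn.mul_right (X * pairSeries M (n + 1))) using 1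
        linear_combination -pairSeries_succ M n

/-- The first-order expansion of `goodSeries n (μ + 1)`. -/
noncomputable def firstOrder (M n μ : ℕ) : ℚ⟦X⟧ :=
  pairSeries M (μ + 1) * (1 - X ^ n * (1 - X)⁻¹) -
    X ^ (n - 1) * (1 + X) * (1 - X)⁻¹ * pairSeries M μ

theorem sum_firstOrder (M n μ : ℕ) :
    ∑ v ∈ Finset.range μ, X ^ (v + 1) * firstOrder M (n + 1) v +
      pairSeries M 0 * (1 - X ^ (n + 1) * (1 - X)⁻¹) =
    pairSeries M μ * (1 - X ^ (n + 1) * (1 - X)⁻¹) -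
      X ^ (n + 1) * (1 + X) * (1 - X)⁻¹ *
        ∑ v ∈ Finset.range μ, X ^ v * pairSeries M v := by
  induction μ with
  | zero => simp
  | succ μ ih =>
    rw [Finset.sum_range_succ, Finset.sum_range_succ, firstOrder, Nat.add_sub_cancel]
    linear_combination ih - (1 - X ^ (n + 1) * (1 - X : ℚ⟦X⟧)⁻¹) * pairSeries_succ M μ

/-- For thresholds near `n` the prefactor already has order about n, so the zeroth-order
approximation suffices. -/
theorem X_pow_dvd_goodSeries_sub_firstOrder_of_large {M n v e : ℕ} (hn : 1 ≤ n) (hM : 2 * n ≤ M)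
    (hv : v + 1 ≤ n) (hv' : n ≤ v + 2) (he : e + 2 ≤ 2 * n) :
    X ^ e ∣ X ^ (v + 1) * (goodSeries n (v + 1) - firstOrder M n v) := by
  obtain ⟨m, rfl⟩ := Nat.exists_eq_add_of_le' hn
  obtain ⟨w, hw⟩ := X_pow_dvd_goodSeries_sub_pairSeries (m + 1) (v + 1) m hM hv le_rfl
  have h : (X ^ e : ℚ⟦X⟧) ∣ X ^ (v + 1) * X ^ m := by
    rw [← pow_add]; exact pow_dvd_pow X (by omega)
  convert h.mul_right (w + X * (1 - X)⁻¹ * pairSeries M (v + 1) +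
    (1 + X) * (1 - X)⁻¹ * pairSeries M v) using 1
  rw [firstOrder, Nat.add_sub_cancel]
  linear_combination X ^ (v + 1) * hw

theorem X_pow_dvd_sum_goodSeries {M n m e : ℕ} (hn : 3 ≤ n) (hM : 2 * n ≤ M) (hm : m ≤ n)
    (he : e + 2 ≤ 2 * n)
    (ih : ∀ μ e, μ + 3 ≤ n → e + 4 ≤ 2 * n → X ^ e ∣ goodSeries n (μ + 1) - firstOrder M n μ) :
    X ^ e ∣ ∑ v ∈ Finset.range (m + 1), X ^ v * goodSeries n v -
      (pairSeries M m * (1 - X ^ n * (1 - X)⁻¹) - X ^ n * (1 + X) * (1 - X)⁻¹ *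
        ∑ v ∈ Finset.range m, X ^ v * pairSeries M v) := by
  obtain ⟨n, rfl⟩ := Nat.exists_eq_add_of_le' (show 2 ≤ n by omega)
  rw [← sum_firstOrder, Finset.sum_range_succ', pow_zero, one_mul, add_sub_add_comm,
    ← Finset.sum_sub_distrib]
  refine dvd_add (Finset.dvd_sum fun v hv => ?_)
    (X_pow_dvd_goodSeries_at_zero (by omega) (by omega) hM)
  have hv := Finset.mem_range.1 hv
  rw [← mul_sub]
  rcases le_or_gt (n + 2) (v + 2) with h | h
  · exact X_pow_dvd_goodSeries_sub_firstOrder_of_large (by omega) hM (by omega) h he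
  -- The precision must grow by 2 per step. The factor x^(v+1) provides this only for v ≥ 1, so
  -- threshold 1 needs its closed form.
  rcases Nat.eq_zero_or_pos v with rfl | hv0
  · exact (X_pow_dvd_goodSeries_at_one (by omega) (by omega)).mul_left _
  · refine (pow_dvd_pow X (show e ≤ v + 1 + (e - 2) by omega)).trans ?_
    rw [pow_add]
    exact mul_dvd_mul_left _ (ih v (e - 2) (by omega) (by omega))

theorem X_pow_dvd_goodSeries_sub_firstOrder {M n : ℕ} (hn : 3 ≤ n) (hM : 2 * n ≤ M) :
    ∀ μ e, μ + 3 ≤ n → e + 4 ≤ 2 * n → X ^ e ∣ goodSeries n (μ + 1) - firstOrder M n μ := by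
  induction n, hn using Nat.le_induction with
  | base =>
    intro μ e hμ he
    obtain rfl : μ = 0 := by omega
    exact X_pow_dvd_goodSeries_at_one (n := 1) (by omega) (by omega)
  | succ n hn ih =>
    intro μ e hμ he
    obtain ⟨w, hw⟩ := X_pow_dvd_sum_goodSeries (m := μ + 1) (e := e) hn (by omega) (by omega)
      (by omega) (ih (by omega))
    -- The extra term x^n G(n, μ+1) needs only zeroth-order precision; it turns -x^n/(1-x) into
    -- -x^(n+1)/(1-x).
    obtain ⟨u, hu⟩ := X_pow_dvd_goodSeries_sub_pairSeries (M := M) n (μ + 1) (n - 1) (by omega)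
      (by omega) (by omega)
    have h2 : (X ^ e : ℚ⟦X⟧) ∣ X ^ n * X ^ (n - 1) := by
      rw [← pow_add]; exact pow_dvd_pow X (by omega)
    rw [sum_X_pow_mul_pairSeries] at hw
    rw [goodSeries_succ_of_lt (by omega), firstOrder, Nat.add_sub_cancel]
    convert (dvd_mul_right (X ^ e) w).add (h2.mul_right u) using 1
    linear_combination hw + X ^ n * hu -
      X ^ n * pairSeries M (μ + 1) * one_sub_X_mul_inv

/-- Replacing P_n by P_M costs a further x^(n+1)/(1-x); the total x^n + x^(n+1) + x^n(1+x) explains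
the factor 2 + 2x. -/
theorem X_pow_dvd_goodSeries_self {M n e : ℕ} (hn : 3 ≤ n) (hM : 2 * n ≤ M) (he : e + 2 ≤ 2 * n) :
    X ^ e ∣ goodSeries (n + 1) (n + 1) -
      pairSeries M M * (1 - X ^ n * (2 + 2 * X) * (1 - X)⁻¹) := by
  obtain ⟨w, hw⟩ := X_pow_dvd_sum_goodSeries (m := n) hn hM le_rfl he
    (X_pow_dvd_goodSeries_sub_firstOrder hn hM)
  obtain ⟨m, rfl⟩ := Nat.exists_eq_add_of_le' (show 1 ≤ n by omega)
  rw [sum_X_pow_mul_pairSeries] at hw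
  obtain ⟨t, ht⟩ := X_pow_dvd_prod_one_add (-1) (n := m + 2) (M := M + 1) (e := e)
    (by omega) (by omega) (by omega)
  obtain ⟨s, hs⟩ := X_pow_dvd_prod_one_add (-1) (n := m + 1) (M := M + 1) (e := m + 1)
    (by omega) (by omega) (by omega)
  have h1 := pairSeries_eq_mul_prod M (show m + 1 ≤ M by omega)
  have h2 := pairSeries_eq_mul_prod M (show m ≤ M by omega)
  rw [sub_eq_iff_eq_add.1 ht] at h1
  rw [sub_eq_iff_eq_add.1 hs] at h2
  have h3 : (X ^ e : ℚ⟦X⟧) ∣ X ^ (m + 1) * X ^ (m + 1) := by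
    rw [← pow_add]; exact pow_dvd_pow X (by omega)
  rw [goodSeries_succ_of_le (by omega)]
  set Q := pairSeries M M
  set y := (1 - X : ℚ⟦X⟧)⁻¹
  convert ((dvd_mul_right (X ^ e) w).add
    ((dvd_mul_right (X ^ e) t).mul_right (Q * (1 - X ^ (m + 1) * y)))).add
    (h3.mul_right (Q * X * y ^ 2 - (1 + X) * y * Q * (s - y))) using 1
  linear_combination hw + (1 - X ^ (m + 1) * y) * h1 - X ^ (m + 1) * (1 + X) * y * h2

/-! ### Passage to the infinite product. -/

theorem X_pow_dvd_overpartitionSeries_sub_prod (N : ℕ) :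
    X ^ (N + 1) ∣ overpartitionSeries -
      ∏ i ∈ Finset.range N, (1 + X ^ (i + 1) : ℚ⟦X⟧) * (1 - X ^ (i + 1))⁻¹ := by
  have key : ∀ m, N ≤ m → X ^ (N + 1) ∣
      ∏ i ∈ Finset.range m, (1 + X ^ (i + 1) : ℚ⟦X⟧) * (1 - X ^ (i + 1))⁻¹ -
      ∏ i ∈ Finset.range N, (1 + X ^ (i + 1) : ℚ⟦X⟧) * (1 - X ^ (i + 1))⁻¹ := by
    intro m hm
    induction m, hm using Nat.le_induction with
    | base => simp
    | succ m hm ih =>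
      rw [Finset.prod_range_succ]
      set P := ∏ i ∈ Finset.range m, (1 + X ^ (i + 1) : ℚ⟦X⟧) * (1 - X ^ (i + 1))⁻¹
      have h : (X ^ (N + 1) : ℚ⟦X⟧) ∣ X ^ (m + 1) := pow_dvd_pow X (by omega)
      convert ih.add (h.mul_right (2 * (1 - X ^ (m + 1))⁻¹ * P)) using 1
      linear_combination P * one_sub_X_pow_mul_inv m
  rw [X_pow_dvd_iff]
  intro k hk
  have hlim := ((WithPiTopology.continuous_coeff ℚ k).tendsto _).comp
    multipliable_overpartitionSeries.hasProd.tendsto_prod_nat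
  rw [map_sub, sub_eq_zero]
  refine tendsto_nhds_unique hlim (tendsto_const_nhds.congr' ?_)
  filter_upwards [Filter.eventually_ge_atTop N] with m hm
  have := X_pow_dvd_iff.1 (key m hm) k hk
  rw [map_sub, sub_eq_zero] at this
  exact this.symm

theorem X_pow_dvd_overpartitionSeries_sub_pairSeries (M : ℕ) :
    X ^ M ∣ overpartitionSeries - pairSeries M M := by
  rcases Nat.eq_zero_or_pos M with rfl | hM
  · simp
  obtain ⟨w, hw⟩ := X_pow_dvd_overpartitionSeries_sub_prod M
  -- `pairSeries M M` stops at distinct parts below `M`, so it lacks the factor 1 + x^M.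
  have h : pairSeries M M * (1 + X ^ M) =
      ∏ i ∈ Finset.range M, (1 + X ^ (i + 1) : ℚ⟦X⟧) * (1 - X ^ (i + 1))⁻¹ := by
    rw [Finset.prod_mul_distrib, pairSeries, Finset.range_eq_Ico,
      Finset.prod_Ico_add' (fun i => (1 + X ^ i : ℚ⟦X⟧)) 0 M 1, Finset.prod_Ico_succ_top (by omega)]
    ring
  exact ⟨X * w + pairSeries M M, by linear_combination hw - h⟩

/-! ### Coefficient formulas and the theorem. -/

theorem av_eq_coeff {n k : ℕ} (hn : 4 ≤ n) (hk : k + 5 ≤ 2 * n) :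
    (av n k basis1324And1342 : ℚ) =
      coeff k ((1 - X - X ^ (n - 1) * (2 + 2 * X)) * (1 - X)⁻¹ * overpartitionSeries) := by
  obtain ⟨n, rfl⟩ := Nat.exists_eq_add_of_le' (show 1 ≤ n by omega)
  rw [← coeff_goodSeries, ← sub_eq_zero, ← map_sub, Nat.add_sub_cancel]
  refine X_pow_dvd_iff.1 ?_ k (Nat.lt_succ_self k)
  have h1 := X_pow_dvd_goodSeries_self (M := 2 * n) (e := k + 1) (show 3 ≤ n by omega) le_rfl
    (by omega)
  have h2 := (pow_dvd_pow (X : ℚ⟦X⟧) (show k + 1 ≤ 2 * n by omega)).trans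
    (X_pow_dvd_overpartitionSeries_sub_pairSeries (2 * n))
  convert h1.sub (h2.mul_right (1 - X ^ n * (2 + 2 * X) * (1 - X)⁻¹)) using 1
  linear_combination -overpartitionSeries * one_sub_X_mul_inv

theorem isLimitGenFun_overpartitionSeries :
    IsLimitGenFun basis1324And1342 overpartitionSeries := by
  refine fun k => ⟨k + 5, fun n hn => ?_⟩
  rw [av_eq_coeff (by omega) (by omega), ← sub_eq_zero, ← map_sub]
  refine X_pow_dvd_iff.1 ?_ k (show k < n - 1 by omega)
  refine ⟨-(2 + 2 * X) * (1 - X)⁻¹ * overpartitionSeries, ?_⟩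
  linear_combination overpartitionSeries * one_sub_X_mul_inv

/-- Each coefficient is eventually a cardinality. -/
theorem coeff_overpartitionSeries_nonneg (k : ℕ) : 0 ≤ coeff k overpartitionSeries := by
  obtain ⟨N, hN⟩ := isLimitGenFun_overpartitionSeries k
  rw [← hN N le_rfl]
  exact Nat.cast_nonneg _

theorem theorem6p12 :
    IsLimitGenFun basis1324And1342 overpartitionSeries ∧
    ∀ k n : ℕ, ((k : ℚ) + 7) / 2 ≤ (n : ℚ) →
      0 ≤ (av (n + 1) k basis1324And1342 : ℚ) - (av n k basis1324And1342 : ℚ) ∧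
      (av (n + 1) k basis1324And1342 : ℚ) - (av n k basis1324And1342 : ℚ)
        = coeff k (X ^ (n - 1) * (2 + 2 * X) * overpartitionSeries) ∧
      (av n k basis1324And1342 : ℚ)
        = coeff k ((1 - X - X ^ (n - 1) * (2 + 2 * X)) * (1 - X)⁻¹ * overpartitionSeries) := by
  refine ⟨isLimitGenFun_overpartitionSeries, fun k n h => ?_⟩
  have hk : k + 7 ≤ 2 * n := by
    have : (k : ℚ) + 7 ≤ 2 * n := by linarith
    exact_mod_cast this
  have hdiff : (av (n + 1) k basis1324And1342 : ℚ) - (av n k basis1324And1342 : ℚ)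
      = coeff k (X ^ (n - 1) * (2 + 2 * X) * overpartitionSeries) := by
    rw [av_eq_coeff (by omega) (by omega), av_eq_coeff (by omega) (by omega), ← map_sub]
    congr 1
    obtain ⟨m, rfl⟩ := Nat.exists_eq_add_of_le' (show 1 ≤ n by omega)
    simp only [Nat.add_sub_cancel]
    linear_combination (X ^ m * (2 + 2 * X) * overpartitionSeries) * one_sub_X_mul_inv
  refine ⟨?_, hdiff, av_eq_coeff (by omega) (by omega)⟩
  have hsplit : X ^ (n - 1) * (2 + 2 * X) * overpartitionSeries =
      2 • (X ^ (n - 1) * overpartitionSeries) + 2 • (X ^ (n - 1 + 1) * overpartitionSeries) := by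
    simp only [nsmul_eq_mul, Nat.cast_ofNat]
    ring
  rw [hdiff, hsplit, map_add, map_nsmul, map_nsmul, coeff_X_pow_mul', coeff_X_pow_mul']
  have hc := coeff_overpartitionSeries_nonneg
  refine add_nonneg (nsmul_nonneg ?_ _) (nsmul_nonneg ?_ _) <;> split_ifs <;>
    first | exact hc _ | exact le_rfl
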